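/- Let $N,M$ be positive integers and consider an undirected weighted multiplex network with $N$ nodes and $M$ layers: symmetric intralayer weights $w^{[\alpha]}_{ij}=w^{[\alpha]}_{ji}\ge 0$, intralayer diffusion constants $D^{[\alpha]}\ge 0$ and symmetric interlayer diffusion constants $D^{[\alpha,\beta]}=D^{[\beta,\alpha]}\ge 0$ ($\alpha\ne\beta$). Its supra-Laplacian $\mathcal L\in\mathbb R^{NM\times NM}$ acts on vectors $y=(y_i^{[\alpha]})$ by $$(\mathcal L y)_i^{[\alpha]}=D^{[\alpha]}\sum_{j=1}^N w^{[\alpha]}_{ij}\bigl(y_i^{[\alpha]}-y_j^{[\alpha]}\bigr)+\sum_{\beta\neq\alpha}D^{[\alpha,\beta]}\bigl(y_i^{[\alpha]}-y_i^{[\beta]}\bigr).$$ Assume that the network is connected, i.e. any replica node $(i,\alpha)$ can be reached from any other one along intralinks $(i,\alpha)\sim(j,\alpha)$ with $D^{[\alpha]}w^{[\alpha]}_{ij}>0$ and interlinks $(i,\alpha)\sim(i,\beta)$ with $D^{[\alpha,\beta]}>0$. Let $\tilde f:\mathbb R^{NM}\to\mathbb R$ be convex and twice continuously differentiable, and assume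 that the original problem $$\min_{x\in\mathbb R} f(x),\qquad f(x)=\tilde f(x\mathbf 1),$$ has a minimizer (for $\tilde f(y)=\sum_{\alpha}\sum_i f_i^{[\alpha]}(y_i^{[\alpha]})$ one has $f(x)=\sum_{\alpha}\sum_i f_i^{[\alpha]}(x)$). Let $$\mathcal L_a(y,\lambda)=\tilde f(y)+\lambda^{\top}\mathcal L y+\tfrac12 y^{\top}\mathcal L y.$$ Then every trajectory $(y(t),\lambda(t))$, $t\ge 0$, of the saddle-point flow $$\dot y=-\nabla\tilde f(y)-\mathcal L y-\mathcal L\lambda,\qquad \dot\lambda=\mathcal L y$$ converges as $t\to\infty$ to a single point $(y^\star,\lambda^\star)$, which is a saddle point of $\mathcal L_a$, that is, $\mathcal L_a(y^\star,\lambda)\le\mathcal L_a(y^\star,\lambda^\star)\le\mathcal L_a(y,\lambda^\star)$ for all $y,\lambda\in\mathbb R^{NM}$. Moreover: 1. $y^\star=x^\star\mathbf 1$, where $x^\star\in\mathbb R$ is a minimizer of the original problem; 2. $\lambda^\star=\bar\lambda+\operatorname{average}(\lambda(0))\,\mathbf 1$, where $\operatorname{average}(\lambda(0))$ is the mean of the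 $NM$ entries of $\lambda(0)$, and $\bar\lambda\perp\mathbf 1$ satisfies $\mathcal L\bar\lambda+\nabla\tilde f(y^\star)=0$. -/

import Mathlib

open Set Filter Topology

/-- An undirected weighted multiplex network with `N` nodes and `M` layers. The replica node of
node `i` in layer `α` is the pair `(i, α)`. -/
structure MultiplexNetwork (N M : ℕ) where
  /-- `w α i j` is the weight of the intralink between `(i, α)` and `(j, α)` (`0`: no link). -/
  w : Fin M → Fin N → Fin N → ℝ
  w_symm : ∀ α i j, w α i j = w α j i
  w_nonneg : ∀ α i j, 0 ≤ w α i j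
  /-- The intralayer diffusion constants. -/
  D : Fin M → ℝ
  D_nonneg : ∀ α, 0 ≤ D α
  /-- The interlayer diffusion constants (the diagonal values play no role). -/
  Dinter : Fin M → Fin M → ℝ
  Dinter_symm : ∀ α β, Dinter α β = Dinter β α
  Dinter_nonneg : ∀ α β, 0 ≤ Dinter α β

/-- The space of vectors `y = (y_i^[α])` indexed by the replica nodes, with the Euclidean norm. -/
abbrev ReplicaSpace (N M : ℕ) : Type := EuclideanSpace ℝ (Fin N × Fin M)

/-- The all-ones vector. -/
noncomputable def onesVec (N M : ℕ) : ReplicaSpace N M := WithLp.toLp 2 (fun _ => 1)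

/-- The average of the entries of a vector. -/
noncomputable def replicaAverage {N M : ℕ} (v : ReplicaSpace N M) : ℝ :=
  (∑ p, v p) / ((N : ℝ) * (M : ℝ))

namespace MultiplexNetwork

variable {N M : ℕ} (G : MultiplexNetwork N M)

/-- The graph on the replica nodes whose edges are the intralinks and interlinks along which
diffusion takes place, that is, those with positive diffusion coefficient. -/
def replicaGraph : SimpleGraph (Fin N × Fin M) where
  Adj p q := p ≠ q ∧
    ((p.2 = q.2 ∧ 0 < G.D p.2 * G.w p.2 p.1 q.1) ∨ (p.1 = q.1 ∧ 0 < G.Dinter p.2 q.2))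
  symm := ⟨by
    rintro ⟨i, α⟩ ⟨j, β⟩ ⟨hne, h⟩
    refine ⟨hne.symm, ?_⟩
    rcases h with ⟨h1, h2⟩ | ⟨h1, h2⟩
    · left
      dsimp only at h1 h2 ⊢
      subst h1
      exact ⟨rfl, by rw [G.w_symm]; exact h2⟩
    · right
      exact ⟨h1.symm, by rw [G.Dinter_symm]; exact h2⟩⟩
  loopless := ⟨fun _ h => h.1 rfl⟩

/-- Any replica node can be reached from any other one through intralinks and interlinks
(and there is at least one replica node). -/
def Connected : Prop := G.replicaGraph.Connected

/-- The Laplacian of layer `α`, with entries `s_i δ_ij - w_ij` where `s_i = ∑ j, w_ij`. -/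
def layerLaplacian (α : Fin M) : Matrix (Fin N) (Fin N) ℝ :=
  Matrix.diagonal (fun i => ∑ j, G.w α i j) - Matrix.of (G.w α)

/-- The block diagonal intralayer part, with blocks `D^[α] L^[α]`. -/
def intraPart : Matrix (Fin N × Fin M) (Fin N × Fin M) ℝ :=
  Matrix.blockDiagonal (fun α => G.D α • G.layerLaplacian α)

/-- The interlayer part: the block `(α, α)` is `(∑ β ≠ α, D^[α,β]) I` and, for `α ≠ β`, the block
`(α, β)` is `- D^[α,β] I`. -/
def interPart : Matrix (Fin N × Fin M) (Fin N × Fin M) ℝ :=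
  Matrix.of fun p q =>
    if p.1 = q.1 then
      if p.2 = q.2 then ∑ β ∈ Finset.univ.erase p.2, G.Dinter p.2 β else - G.Dinter p.2 q.2
    else 0

/-- The supra-Laplacian matrix. -/
def supraLaplacian : Matrix (Fin N × Fin M) (Fin N × Fin M) ℝ :=
  G.intraPart + G.interPart

/-- The supra-Laplacian as a linear operator on the space of replica vectors. -/
noncomputable def supraLap : ReplicaSpace N M →ₗ[ℝ] ReplicaSpace N M :=
  Matrix.toEuclideanLin G.supraLaplacian

/-- The augmented supra-Lagrangian `f(y) + lᵀ 𝓛 y + (1/2) yᵀ 𝓛 y`. -/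
noncomputable def augLagrangian (f : ReplicaSpace N M → ℝ) (y l : ReplicaSpace N M) : ℝ :=
  f y + inner ℝ l (G.supraLap y) + (1 / 2) * inner ℝ y (G.supraLap y)

/-- `(y, l)` is a trajectory, on `[0, ∞)`, of the saddle-point dynamics
`y' = -∇f(y) - 𝓛 y - 𝓛 l`, `l' = 𝓛 y`. -/
structure IsTrajectory (f : ReplicaSpace N M → ℝ) (y l : ℝ → ReplicaSpace N M) : Prop where
  primal : ∀ t, 0 ≤ t → HasDerivWithinAt y
    (-gradient f (y t) - G.supraLap (y t) - G.supraLap (l t)) (Ici 0) t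
  dual : ∀ t, 0 ≤ t → HasDerivWithinAt l (G.supraLap (y t)) (Ici 0) t

end MultiplexNetwork

/-- The objective `x ↦ f(x, …, x)` of the original problem over one scalar decision variable. -/
noncomputable def primalObjective {N M : ℕ} (f : ReplicaSpace N M → ℝ) (x : ℝ) : ℝ :=
  f (x • onesVec N M)

/-- For a sum of individual costs, the objective of the original problem is `∑_α ∑_i f_i^[α](x)`. -/
theorem primalObjective_sum {N M : ℕ} (c : Fin M → Fin N → ℝ → ℝ) (x : ℝ) :
    primalObjective (fun y : ReplicaSpace N M => ∑ α, ∑ i, c α i (y (i, α))) x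
      = ∑ α, ∑ i, c α i x := by
  simp [primalObjective, onesVec]

/-!
The squared distance of the saddle-point flow from an equilibrium `(a, b)` is nonincreasing, and by
Barbalat's lemma its derivative tends to zero along every trajectory. This derivative controls both
`A y`, where `A` is the supra-Laplacian, and the defect in the monotonicity of `∇f`; a second use of
Barbalat's lemma shows that `A y'` tends to zero as well. Every cluster point `(u, v)` of the
trajectory therefore satisfies `A u = 0`, `∇f u = ∇f a` and `A (∇f u + A v) = 0`, which makes it an
equilibrium. The squared distance from that equilibrium is nonincreasing too and has `0` as a
cluster value, so the trajectory converges. Connectedness means that the kernel of `A` is spanned by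
the all-ones vector: equilibria are the solutions of the original problem with their multipliers,
and the average of `l`, which the flow conserves, is the average of the limiting multiplier.
-/

section ConvexGradient

open scoped Gradient InnerProductSpace

variable {E : Type*} [NormedAddCommGroup E] [InnerProductSpace ℝ E] [CompleteSpace E]
  {f : E → ℝ} {s : Set E} {x z : E}

theorem add_inner_gradient_le_of_convexOn (hconv : ConvexOn ℝ s f) (hx : x ∈ s) (hz : z ∈ s)
    (hf : DifferentiableAt ℝ f x) : f x + ⟪∇ f x, z - x⟫_ℝ ≤ f z := by
  have hline : HasDerivAt (f ∘ AffineMap.lineMap (k := ℝ) x z) ⟪∇ f x, z - x⟫_ℝ 0 := by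
    have hfx : HasFDerivAt f (fderiv ℝ f x) (AffineMap.lineMap (k := ℝ) x z 0) := by
      simpa using hf.hasFDerivAt
    simpa [inner_gradient_left] using hfx.comp_hasDerivAt (0 : ℝ) AffineMap.hasDerivAt_lineMap
  have hslope := (hconv.comp_affineMap (AffineMap.lineMap (k := ℝ) x z)).le_slope_of_hasDerivAt
    (by simpa using hx) (by simpa using hz) one_pos hline
  simp only [slope_def_field, Function.comp_apply, AffineMap.lineMap_apply_zero,
    AffineMap.lineMap_apply_one, sub_zero, div_one] at hslope
  linarith

theorem gradient_eq_of_eventually_add_inner_le {g : E} (hf : DifferentiableAt ℝ f x)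
    (hg : ∀ᶠ z in 𝓝 x, f x + ⟪g, z - x⟫_ℝ ≤ f z) : ∇ f x = g := by
  have hmin : IsLocalMin (fun z => f z - ⟪g, z⟫_ℝ) x := by
    filter_upwards [hg] with z hz
    rw [inner_sub_right] at hz
    linarith
  have hzero : fderiv ℝ f x - innerSL ℝ g = 0 :=
    hmin.hasFDerivAt_eq_zero (hf.hasFDerivAt.sub (innerSL ℝ g).hasFDerivAt)
  refine ext_inner_right ℝ fun v => ?_
  rw [inner_gradient_left, sub_eq_zero.1 hzero, innerSL_apply_apply]

theorem inner_gradient_sub_nonneg_of_convexOn (hconv : ConvexOn ℝ s f) (hx : x ∈ s) (hz : z ∈ s)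
    (hfx : DifferentiableAt ℝ f x) (hfz : DifferentiableAt ℝ f z) :
    0 ≤ ⟪∇ f x - ∇ f z, x - z⟫_ℝ := by
  have hxz := add_inner_gradient_le_of_convexOn hconv hx hz hfx
  have hzx := add_inner_gradient_le_of_convexOn hconv hz hx hfz
  rw [← neg_sub x z, inner_neg_right] at hxz
  rw [inner_sub_left]
  linarith

theorem gradient_eq_of_inner_gradient_sub_eq_zero (hconv : ConvexOn ℝ univ f)
    (hfx : DifferentiableAt ℝ f x) (hfz : DifferentiableAt ℝ f z)
    (h : ⟪∇ f x - ∇ f z, x - z⟫_ℝ = 0) : ∇ f x = ∇ f z := by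
  -- Equality in the monotonicity estimate makes `∇ f z` a subgradient of `f` at `x`.
  refine gradient_eq_of_eventually_add_inner_le hfx (Eventually.of_forall fun u => ?_)
  have hxz := add_inner_gradient_le_of_convexOn hconv (mem_univ x) (mem_univ z) hfx
  have hzu := add_inner_gradient_le_of_convexOn hconv (mem_univ z) (mem_univ u) hfz
  simp only [inner_sub_left, inner_sub_right] at h hxz hzu ⊢
  linarith

theorem continuous_gradient_of_convexOn [FiniteDimensional ℝ E] (hconv : ConvexOn ℝ univ f)
    (hf : Differentiable ℝ f) : Continuous (∇ f) := by
  have := FiniteDimensional.proper ℝ E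
  refine continuous_iff_continuousAt.2 fun x => ?_
  obtain ⟨K, t, ht, hK⟩ := hconv.locallyLipschitz x
  have hbound : ∀ᶠ u in 𝓝 x, ∇ f u ∈ Metric.closedBall 0 (K : ℝ) := by
    filter_upwards [eventually_mem_nhds_iff.2 ht] with u hu
    rw [mem_closedBall_zero_iff, gradient, LinearIsometryEquiv.norm_map]
    exact norm_fderiv_le_of_lipschitzOn ℝ hu hK
  -- A limit of subgradients is a subgradient at the limit point, hence equal to the gradient.
  refine (isCompact_closedBall 0 (K : ℝ)).tendsto_nhds_of_unique_mapClusterPt hbound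
    fun g _ hg => ?_
  obtain ⟨U, hUx, hUg⟩ := mapClusterPt_iff_ultrafilter.1 hg
  refine (gradient_eq_of_eventually_add_inner_le (hf x) (Eventually.of_forall fun z => ?_)).symm
  have hlim : Tendsto (fun u => f u + ⟪∇ f u, z - u⟫_ℝ) U (𝓝 (f x + ⟪g, z - x⟫_ℝ)) :=
    (hf.continuous.continuousAt.tendsto.mono_left hUx).add
      (hUg.inner ((continuous_const.sub continuous_id).continuousAt.tendsto.mono_left hUx))
  exact le_of_tendsto' hlim fun u =>
    add_inner_gradient_le_of_convexOn hconv (mem_univ u) (mem_univ z) (hf u)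

theorem gradient_mem_orthogonal_of_isMinOn {K : Submodule ℝ E} (hf : DifferentiableAt ℝ f x)
    (hx : x ∈ K) (hmin : IsMinOn f K x) : ∇ f x ∈ Kᗮ := by
  have htangent : ∀ v ∈ K, v ∈ posTangentConeAt (K : Set E) x := fun v hv =>
    mem_posTangentConeAt_of_segment_subset (K.convex.segment_subset hx (K.add_mem hx hv))
  refine (Submodule.mem_orthogonal' _ _).2 fun v hv => ?_
  rw [inner_gradient_left]
  exact hmin.localize.hasFDerivWithinAt_eq_zero hf.hasFDerivAt.hasFDerivWithinAt
    (htangent v hv) (htangent _ (K.neg_mem hv))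

end ConvexGradient

section HalfLine

variable {F : Type*} [NormedAddCommGroup F] [NormedSpace ℝ F] {a : ℝ}

theorem exists_tendsto_atTop_of_antitoneOn_Ici {g : ℝ → ℝ} (hg : AntitoneOn g (Ici a))
    (hbdd : BddBelow (g '' Ici a)) : ∃ c, Tendsto g atTop (𝓝 c) :=
  ⟨_, tendsto_comp_val_Ici_atTop.1 (tendsto_atTop_ciInf (antitoneOn_iff_antitone.1 hg)
    (by simpa only [image_eq_range] using hbdd))⟩

theorem norm_add_sub_sub_smul_le_of_hasDerivWithinAt {g g' : ℝ → F} {t h C : ℝ} (v : F)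
    (hh : 0 ≤ h) (hg : ∀ s ∈ Icc t (t + h), HasDerivWithinAt g (g' s) (Icc t (t + h)) s)
    (hC : ∀ s ∈ Icc t (t + h), ‖g' s - v‖ ≤ C) : ‖g (t + h) - g t - h • v‖ ≤ C * h := by
  have hderiv : ∀ s ∈ Icc t (t + h),
      HasDerivWithinAt (fun s => g s - s • v) (g' s - v) (Icc t (t + h)) s := fun s hs => by
    simpa using (hg s hs).fun_sub ((hasDerivWithinAt_id s _).smul_const v)
  have hmean := (convex_Icc t (t + h)).norm_image_sub_le_of_norm_hasDerivWithin_le hderiv hC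
    (left_mem_Icc.2 (by linarith)) (right_mem_Icc.2 (by linarith))
  rw [add_sub_cancel_left, Real.norm_of_nonneg hh] at hmean
  convert hmean using 2
  rw [add_smul]
  abel

/-- Barbalat's lemma. -/
theorem tendsto_zero_of_hasDerivWithinAt_of_uniformContinuousOn {g g' : ℝ → F} {c : F}
    (hg : ∀ t ∈ Ici a, HasDerivWithinAt g (g' t) (Ici a) t) (hlim : Tendsto g atTop (𝓝 c))
    (huc : UniformContinuousOn g' (Ici a)) : Tendsto g' atTop (𝓝 0) := by
  refine Metric.tendsto_nhds.2 fun ε hε => ?_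
  obtain ⟨δ, hδ, hg'δ⟩ := Metric.uniformContinuousOn_iff.1 huc (ε / 2) (half_pos hε)
  obtain ⟨h, hh, hhδ⟩ := exists_between hδ
  have hdiff : Tendsto (fun t => g (t + h) - g t) atTop (𝓝 0) := by
    simpa using (hlim.comp (tendsto_atTop_add_const_right _ h tendsto_id)).sub hlim
  filter_upwards [eventually_ge_atTop a,
    Metric.tendsto_nhds.1 hdiff (ε / 2 * h) (by positivity)] with t hat hsmall
  have hsub : Icc t (t + h) ⊆ Ici a := fun s hs => hat.trans hs.1
  have hmean : ‖g (t + h) - g t - h • g' t‖ ≤ ε / 2 * h := by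
    refine norm_add_sub_sub_smul_le_of_hasDerivWithinAt (g' t) hh.le
      (fun s hs => (hg s (hsub hs)).mono hsub) fun s hs => ?_
    rw [← dist_eq_norm]
    refine (hg'δ s (hsub hs) t hat ?_).le
    rw [Real.dist_eq, abs_of_nonneg (sub_nonneg.2 hs.1)]
    linarith [hs.2]
  rw [dist_zero_right] at hsmall ⊢
  refine lt_of_mul_lt_mul_left ?_ hh.le
  calc h * ‖g' t‖ = ‖h • g' t‖ := by rw [norm_smul, Real.norm_of_nonneg hh.le]
    _ ≤ ‖g (t + h) - g t‖ + ‖g (t + h) - g t - h • g' t‖ := norm_le_norm_add_norm_sub _ _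
    _ < ε / 2 * h + ε / 2 * h := add_lt_add_of_lt_of_le hsmall hmean
    _ = h * ε := by ring

end HalfLine

section PositiveOperator

open scoped InnerProductSpace

variable {E : Type*} [NormedAddCommGroup E] [InnerProductSpace ℝ E] {A : E →L[ℝ] E}

theorem norm_sq_apply_le_of_isPositive (hA : A.IsPositive) (v : E) :
    ‖A v‖ ^ 2 ≤ ‖A‖ * ⟪A v, v⟫_ℝ := by
  have hCS : ⟪A v, A v⟫_ℝ ^ 2 ≤ ⟪A v, v⟫_ℝ * ⟪A (A v), A v⟫_ℝ :=
    LinearMap.BilinForm.apply_sq_le_of_symm ((innerₗ E).comp (A : E →ₗ[ℝ] E))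
      hA.inner_nonneg_left
      ⟨fun u v => (hA.inner_left_eq_inner_right u v).trans (real_inner_comm _ _)⟩ v (A v)
  have hop : ⟪A (A v), A v⟫_ℝ ≤ ‖A‖ * ‖A v‖ ^ 2 :=
    calc ⟪A (A v), A v⟫_ℝ ≤ ‖A (A v)‖ * ‖A v‖ := real_inner_le_norm _ _
      _ ≤ ‖A‖ * ‖A v‖ * ‖A v‖ := by gcongr; exact A.le_opNorm _
      _ = ‖A‖ * ‖A v‖ ^ 2 := by ring
  rcases (norm_nonneg (A v)).eq_or_lt with h0 | hpos
  · rw [← h0, zero_pow two_ne_zero]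
    exact mul_nonneg (norm_nonneg A) (hA.inner_nonneg_left v)
  · refine le_of_mul_le_mul_right ?_ (pow_pos hpos 2)
    calc ‖A v‖ ^ 2 * ‖A v‖ ^ 2 = ⟪A v, A v⟫_ℝ ^ 2 := by rw [real_inner_self_eq_norm_sq]; ring
      _ ≤ ⟪A v, v⟫_ℝ * (‖A‖ * ‖A v‖ ^ 2) :=
        hCS.trans (mul_le_mul_of_nonneg_left hop (hA.inner_nonneg_left v))
      _ = ‖A‖ * ⟪A v, v⟫_ℝ * ‖A v‖ ^ 2 := by ring

end PositiveOperator

/-- `(y, l)` is a trajectory, on `[0, ∞)`, of the saddle-point flow `y' = -∇f(y) - A y - A l`,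
`l' = A y` of a function `f` on a Hilbert space with constraint `A y = 0`. -/
structure IsSaddleFlow {E : Type*} [NormedAddCommGroup E] [InnerProductSpace ℝ E] [CompleteSpace E]
    (f : E → ℝ) (A : E →L[ℝ] E) (y l : ℝ → E) : Prop where
  primal : ∀ t ∈ Ici 0, HasDerivWithinAt y (-gradient f (y t) - A (y t) - A (l t)) (Ici 0) t
  dual : ∀ t ∈ Ici 0, HasDerivWithinAt l (A (y t)) (Ici 0) t

/-- `(a, b)` satisfies the optimality conditions for minimizing `f` subject to `A y = 0`, with `b`
as multiplier; these pairs are the rest points of the saddle-point flow. -/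
structure IsSaddleEquilibrium {E : Type*} [NormedAddCommGroup E] [InnerProductSpace ℝ E]
    [CompleteSpace E] (f : E → ℝ) (A : E →L[ℝ] E) (a b : E) : Prop where
  feasible : A a = 0
  stationary : A b + gradient f a = 0

/-- The Lyapunov function of the saddle-point flow: half the squared distance of the state `(u, v)`
from the point `(a, b)`. -/
noncomputable def saddleEnergy {E : Type*} [NormedAddCommGroup E] (a b u v : E) : ℝ :=
  (‖u - a‖ ^ 2 + ‖v - b‖ ^ 2) / 2

/-- The rate at which the saddle-point flow loses the energy relative to an equilibrium with primal
part `a`, when its primal state is `u`. -/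
noncomputable def saddleDissipation {E : Type*} [NormedAddCommGroup E] [InnerProductSpace ℝ E]
    [CompleteSpace E] (f : E → ℝ) (A : E →L[ℝ] E) (a u : E) : ℝ :=
  inner ℝ (gradient f u - gradient f a) (u - a) + inner ℝ (A u) u

section Equilibrium

open scoped Gradient InnerProductSpace

variable {E : Type*} [NormedAddCommGroup E] [InnerProductSpace ℝ E] [CompleteSpace E]
  {f : E → ℝ} {A : E →L[ℝ] E} {a b : E}

theorem exists_isSaddleEquilibrium_of_isMinOn_ker [FiniteDimensional ℝ E] (hA : A.IsSymmetric)
    (hf : DifferentiableAt ℝ f a) (ha : A a = 0) (hmin : IsMinOn f A.ker a) :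
    ∃ b, IsSaddleEquilibrium f A a b := by
  have hrange : ∇ f a ∈ A.range := by
    rw [← Submodule.orthogonal_orthogonal A.range, hA.orthogonal_range]
    exact gradient_mem_orthogonal_of_isMinOn hf ha hmin
  obtain ⟨v, hv⟩ := hrange
  exact ⟨-v, ha, by rw [map_neg, neg_add_eq_zero]; exact hv⟩

namespace IsSaddleEquilibrium

theorem isSaddlePointOn (he : IsSaddleEquilibrium f A a b) (hA : A.IsPositive)
    (hconv : ConvexOn ℝ univ f) (hf : DifferentiableAt ℝ f a) :
    IsSaddlePointOn univ univ (fun u v => f u + ⟪v, A u⟫_ℝ + 1 / 2 * ⟪u, A u⟫_ℝ) a b := by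
  intro u _ v _
  have htangent := add_inner_gradient_le_of_convexOn hconv (mem_univ a) (mem_univ u) hf
  rw [eq_neg_of_add_eq_zero_right he.stationary, inner_neg_left, hA.inner_left_eq_inner_right,
    map_sub, he.feasible, sub_zero] at htangent
  simp only [he.feasible, inner_zero_right, mul_zero, add_zero]
  linarith [hA.inner_nonneg_right u]

theorem isMinOn_ker (he : IsSaddleEquilibrium f A a b) (hA : A.IsPositive)
    (hconv : ConvexOn ℝ univ f) (hf : DifferentiableAt ℝ f a) : IsMinOn f A.ker a := by
  intro u hu
  have hu : A u = 0 := hu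
  have hsaddle := he.isSaddlePointOn hA hconv hf u (mem_univ u) b (mem_univ b)
  simpa only [he.feasible, hu, inner_zero_right, mul_zero, add_zero] using! hsaddle

theorem sub_right (he : IsSaddleEquilibrium f A a b) {v : E} (hv : A v = 0) :
    IsSaddleEquilibrium f A a (b - v) :=
  ⟨he.feasible, by rw [map_sub, hv, sub_zero, he.stationary]⟩

end IsSaddleEquilibrium

theorem saddleDissipation_nonneg (hA : A.IsPositive) (hconv : ConvexOn ℝ univ f)
    (hf : Differentiable ℝ f) (a u : E) : 0 ≤ saddleDissipation f A a u :=
  add_nonneg (inner_gradient_sub_nonneg_of_convexOn hconv (mem_univ u) (mem_univ a) (hf u) (hf a))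
    (hA.inner_nonneg_left u)

theorem norm_sq_apply_le_saddleDissipation (hA : A.IsPositive) (hconv : ConvexOn ℝ univ f)
    (hf : Differentiable ℝ f) (a u : E) : ‖A u‖ ^ 2 ≤ ‖A‖ * saddleDissipation f A a u :=
  (norm_sq_apply_le_of_isPositive hA u).trans (mul_le_mul_of_nonneg_left
    (le_add_of_nonneg_left (inner_gradient_sub_nonneg_of_convexOn hconv (mem_univ u) (mem_univ a)
      (hf u) (hf a))) (norm_nonneg A))

theorem gradient_eq_of_saddleDissipation_eq_zero (hA : A.IsPositive) (hconv : ConvexOn ℝ univ f)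
    (hf : Differentiable ℝ f) {u : E} (hu : saddleDissipation f A a u = 0) : ∇ f u = ∇ f a := by
  have hmono := inner_gradient_sub_nonneg_of_convexOn hconv (mem_univ u) (mem_univ a) (hf u) (hf a)
  exact gradient_eq_of_inner_gradient_sub_eq_zero hconv (hf u) (hf a)
    ((add_eq_zero_iff_of_nonneg hmono (hA.inner_nonneg_left u)).1 hu).1

end Equilibrium

section Limits

open scoped Gradient

theorem tendsto_zero_of_tendsto_norm_sq_zero {E X : Type*} [SeminormedAddCommGroup E]
    {F : Filter X} {g : X → E} (h : Tendsto (fun t => ‖g t‖ ^ 2) F (𝓝 0)) : Tendsto g F (𝓝 0) := by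
  have hsqrt := h.sqrt
  simp only [Real.sqrt_sq (norm_nonneg _), Real.sqrt_zero] at hsqrt
  exact tendsto_zero_iff_norm_tendsto_zero.2 hsqrt

theorem eq_of_mapClusterPt_of_tendsto {X Z W : Type*} [TopologicalSpace Z] [TopologicalSpace W]
    [T2Space W] {F : Filter X} {z : X → Z} {p : Z} {Φ : Z → W} {c : W}
    (hp : MapClusterPt p F z) (hΦ : ContinuousAt Φ p) (hc : Tendsto (fun t => Φ (z t)) F (𝓝 c)) :
    Φ p = c := by
  obtain ⟨U, hU, hlim⟩ := mapClusterPt_iff_ultrafilter.1 hp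
  exact tendsto_nhds_unique (hΦ.tendsto.comp hlim) (hc.mono_left hU)

theorem saddleEnergy_self {E : Type*} [NormedAddCommGroup E] (a b : E) :
    saddleEnergy a b a b = 0 := by
  simp [saddleEnergy]

theorem continuous_saddleEnergy {E : Type*} [NormedAddCommGroup E] (a b : E) :
    Continuous fun p : E × E => saddleEnergy a b p.1 p.2 := by
  unfold saddleEnergy
  fun_prop

theorem tendsto_of_tendsto_saddleEnergy_zero {E X : Type*} [NormedAddCommGroup E] {F : Filter X}
    {y l : X → E} {a b : E} (h : Tendsto (fun t => saddleEnergy a b (y t) (l t)) F (𝓝 0)) :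
    Tendsto y F (𝓝 a) ∧ Tendsto l F (𝓝 b) := by
  have hdouble : Tendsto (fun t => 2 * saddleEnergy a b (y t) (l t)) F (𝓝 0) := by
    simpa using h.const_mul 2
  have hsq : ∀ (x : X → E) (c : E), (∀ t, ‖x t - c‖ ^ 2 ≤ 2 * saddleEnergy a b (y t) (l t)) →
      Tendsto x F (𝓝 c) := fun x c hle =>
    tendsto_sub_nhds_zero_iff.1 (tendsto_zero_of_tendsto_norm_sq_zero
      (squeeze_zero (fun t => sq_nonneg _) hle hdouble))
  refine ⟨hsq y a fun t => ?_, hsq l b fun t => ?_⟩ <;> unfold saddleEnergy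
  · linarith [sq_nonneg ‖l t - b‖]
  · linarith [sq_nonneg ‖y t - a‖]

theorem continuous_saddleDissipation {E : Type*} [NormedAddCommGroup E] [InnerProductSpace ℝ E]
    [CompleteSpace E] {f : E → ℝ} (hgrad : Continuous (∇ f)) (A : E →L[ℝ] E) (a : E) :
    Continuous (saddleDissipation f A a) := by
  unfold saddleDissipation
  fun_prop

end Limits

namespace IsSaddleFlow

open scoped Gradient InnerProductSpace

variable {E : Type*} [NormedAddCommGroup E] [InnerProductSpace ℝ E] [CompleteSpace E]
  {f : E → ℝ} {A : E →L[ℝ] E} {y l : ℝ → E} {a b : E}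

theorem inner_dual_eq (h : IsSaddleFlow f A y l) (hA : A.IsSymmetric) {v : E} (hv : A v = 0)
    {t : ℝ} (ht : 0 ≤ t) : ⟪l t, v⟫_ℝ = ⟪l 0, v⟫_ℝ := by
  have hderiv : ∀ s ∈ Ici (0 : ℝ), HasDerivWithinAt (fun s => ⟪l s, v⟫_ℝ) 0 (Ici 0) s :=
    fun s hs => by
      have hinner := (h.dual s hs).inner ℝ (hasDerivWithinAt_const s (Ici 0) v)
      have hker : ⟪A (y s), v⟫_ℝ = 0 := (hA _ _).trans (by simp [hv])
      simpa only [inner_zero_right, zero_add, hker] using hinner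
  have hconst := (convex_Ici 0).norm_image_sub_le_of_norm_hasDerivWithin_le hderiv
    (fun s _ => norm_zero.le) self_mem_Ici ht
  rw [zero_mul] at hconst
  exact sub_eq_zero.1 (norm_le_zero_iff.1 hconst)

theorem inner_eq_of_tendsto_dual (h : IsSaddleFlow f A y l) (hA : A.IsSymmetric)
    (hb : Tendsto l atTop (𝓝 b)) {v : E} (hv : A v = 0) : ⟪b, v⟫_ℝ = ⟪l 0, v⟫_ℝ := by
  refine tendsto_nhds_unique (hb.inner tendsto_const_nhds) (tendsto_const_nhds.congr' ?_)
  filter_upwards [eventually_ge_atTop 0] with t ht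
  exact (h.inner_dual_eq hA hv ht).symm

theorem hasDerivWithinAt_saddleEnergy (h : IsSaddleFlow f A y l) (hA : A.IsSymmetric)
    (he : IsSaddleEquilibrium f A a b) {t : ℝ} (ht : t ∈ Ici 0) :
    HasDerivWithinAt (fun t => saddleEnergy a b (y t) (l t)) (-saddleDissipation f A a (y t))
      (Ici 0) t := by
  refine ((((h.primal t ht).sub_const a).norm_sq.add
    ((h.dual t ht).sub_const b).norm_sq).div_const 2).congr_deriv ?_
  have hcross : ⟪l t - b, A (y t)⟫_ℝ = ⟪y t - a, A (l t) - A b⟫_ℝ := by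
    rw [← map_sub, ← hA.apply_clm (y t - a), map_sub, he.feasible, sub_zero, real_inner_comm]
  have hquad : ⟪y t - a, A (y t)⟫_ℝ = ⟪A (y t), y t⟫_ℝ := by
    rw [inner_sub_left, ← hA.apply_clm a, he.feasible, inner_zero_left, sub_zero, real_inner_comm]
  rw [hcross, eq_neg_of_add_eq_zero_left he.stationary, saddleDissipation, ← hquad,
    real_inner_comm (y t - a)]
  simp only [inner_sub_right, inner_neg_right]
  ring

theorem antitoneOn_saddleEnergy (h : IsSaddleFlow f A y l) (hA : A.IsPositive)
    (hconv : ConvexOn ℝ univ f) (hf : Differentiable ℝ f) (he : IsSaddleEquilibrium f A a b) :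
    AntitoneOn (fun t => saddleEnergy a b (y t) (l t)) (Ici 0) := by
  have hderiv := fun t ht => h.hasDerivWithinAt_saddleEnergy hA.isSymmetric he (t := t) ht
  exact antitoneOn_of_hasDerivWithinAt_nonpos (convex_Ici 0)
    (fun t ht => (hderiv t ht).continuousWithinAt)
    (fun t ht => (hderiv t (interior_subset ht)).mono interior_subset)
    fun t _ => neg_nonpos.2 (saddleDissipation_nonneg hA hconv hf a (y t))

theorem exists_tendsto_saddleEnergy (h : IsSaddleFlow f A y l) (hA : A.IsPositive)
    (hconv : ConvexOn ℝ univ f) (hf : Differentiable ℝ f) (he : IsSaddleEquilibrium f A a b) :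
    ∃ c, Tendsto (fun t => saddleEnergy a b (y t) (l t)) atTop (𝓝 c) := by
  refine exists_tendsto_atTop_of_antitoneOn_Ici (h.antitoneOn_saddleEnergy hA hconv hf he) ⟨0, ?_⟩
  rintro _ ⟨t, -, rfl⟩
  dsimp only [saddleEnergy]
  positivity

theorem exists_isCompact_mapsTo [FiniteDimensional ℝ E] (h : IsSaddleFlow f A y l)
    (hA : A.IsPositive) (hconv : ConvexOn ℝ univ f) (hf : Differentiable ℝ f)
    (he : IsSaddleEquilibrium f A a b) :
    ∃ K : Set (E × E), IsCompact K ∧ MapsTo (fun t => (y t, l t)) (Ici 0) K := by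
  have := FiniteDimensional.proper ℝ E
  set R := √(2 * saddleEnergy a b (y 0) (l 0))
  refine ⟨Metric.closedBall a R ×ˢ Metric.closedBall b R,
    (isCompact_closedBall a R).prod (isCompact_closedBall b R), fun t ht => ?_⟩
  have henergy : saddleEnergy a b (y t) (l t) ≤ saddleEnergy a b (y 0) (l 0) :=
    h.antitoneOn_saddleEnergy hA hconv hf he self_mem_Ici ht ht
  rw [mem_prod, mem_closedBall_iff_norm, mem_closedBall_iff_norm]
  constructor <;> refine Real.le_sqrt_of_sq_le ?_ <;> unfold saddleEnergy at henergy ⊢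
  · linarith [sq_nonneg ‖l t - b‖]
  · linarith [sq_nonneg ‖y t - a‖]

theorem uniformContinuousOn_comp (h : IsSaddleFlow f A y l) (hgrad : Continuous (∇ f))
    {K : Set (E × E)} (hK : IsCompact K) (hmaps : MapsTo (fun t => (y t, l t)) (Ici 0) K)
    {X : Type*} [UniformSpace X] {Φ : E × E → X} (hΦ : Continuous Φ) :
    UniformContinuousOn (fun t => Φ (y t, l t)) (Ici 0) := by
  obtain ⟨C, hC⟩ := hK.exists_bound_of_continuousOn
    (f := fun p : E × E => (-∇ f p.1 - A p.1 - A p.2, A p.1)) (by fun_prop)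
  have hlip : LipschitzOnWith C.toNNReal (fun t => (y t, l t)) (Ici 0) :=
    (convex_Ici 0).lipschitzOnWith_of_nnnorm_hasDerivWithin_le
      (fun t ht => (h.primal t ht).prodMk (h.dual t ht))
      fun t ht => NNReal.le_toNNReal_of_coe_le (hC _ (hmaps ht))
  exact (hK.uniformContinuousOn_of_continuous hΦ.continuousOn).comp hlip.uniformContinuousOn hmaps

theorem tendsto_saddleDissipation [FiniteDimensional ℝ E] (h : IsSaddleFlow f A y l)
    (hA : A.IsPositive) (hconv : ConvexOn ℝ univ f) (hf : Differentiable ℝ f)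
    (he : IsSaddleEquilibrium f A a b) :
    Tendsto (fun t => saddleDissipation f A a (y t)) atTop (𝓝 0) := by
  have hgrad := continuous_gradient_of_convexOn hconv hf
  obtain ⟨K, hK, hmaps⟩ := h.exists_isCompact_mapsTo hA hconv hf he
  obtain ⟨c, hc⟩ := h.exists_tendsto_saddleEnergy hA hconv hf he
  have huc : UniformContinuousOn (fun t => -saddleDissipation f A a (y t)) (Ici 0) :=
    h.uniformContinuousOn_comp hgrad hK hmaps (Φ := fun p => -saddleDissipation f A a p.1)
      ((continuous_saddleDissipation hgrad A a).comp continuous_fst).neg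
  simpa using (tendsto_zero_of_hasDerivWithinAt_of_uniformContinuousOn
    (fun t ht => h.hasDerivWithinAt_saddleEnergy hA.isSymmetric he ht) hc huc).neg

theorem tendsto_apply_primal [FiniteDimensional ℝ E] (h : IsSaddleFlow f A y l)
    (hA : A.IsPositive) (hconv : ConvexOn ℝ univ f) (hf : Differentiable ℝ f)
    (he : IsSaddleEquilibrium f A a b) : Tendsto (fun t => A (y t)) atTop (𝓝 0) := by
  have hdiss := (h.tendsto_saddleDissipation hA hconv hf he).const_mul ‖A‖
  rw [mul_zero] at hdiss
  exact tendsto_zero_of_tendsto_norm_sq_zero (squeeze_zero (fun t => sq_nonneg _)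
    (fun t => norm_sq_apply_le_saddleDissipation hA hconv hf a (y t)) hdiss)

theorem tendsto_apply_deriv_primal [FiniteDimensional ℝ E] (h : IsSaddleFlow f A y l)
    (hA : A.IsPositive) (hconv : ConvexOn ℝ univ f) (hf : Differentiable ℝ f)
    (he : IsSaddleEquilibrium f A a b) :
    Tendsto (fun t => A (-∇ f (y t) - A (y t) - A (l t))) atTop (𝓝 0) := by
  have hgrad := continuous_gradient_of_convexOn hconv hf
  obtain ⟨K, hK, hmaps⟩ := h.exists_isCompact_mapsTo hA hconv hf he
  exact tendsto_zero_of_hasDerivWithinAt_of_uniformContinuousOn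
    (fun t ht => A.hasFDerivAt.comp_hasDerivWithinAt t (h.primal t ht))
    (h.tendsto_apply_primal hA hconv hf he)
    (h.uniformContinuousOn_comp hgrad hK hmaps (Φ := fun p => A (-∇ f p.1 - A p.1 - A p.2))
      (by fun_prop))

theorem isSaddleEquilibrium_of_mapClusterPt [FiniteDimensional ℝ E] (h : IsSaddleFlow f A y l)
    (hA : A.IsPositive) (hconv : ConvexOn ℝ univ f) (hf : Differentiable ℝ f)
    (he : IsSaddleEquilibrium f A a b) {u v : E}
    (huv : MapClusterPt (u, v) atTop fun t => (y t, l t)) : IsSaddleEquilibrium f A u v := by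
  have hgrad := continuous_gradient_of_convexOn hconv hf
  have hfeasible : A u = 0 := eq_of_mapClusterPt_of_tendsto (p := (u, v)) (Φ := fun p => A p.1) huv
    (by fun_prop) (h.tendsto_apply_primal hA hconv hf he)
  have hdiss : saddleDissipation f A a u = 0 :=
    eq_of_mapClusterPt_of_tendsto (p := (u, v)) (Φ := fun p => saddleDissipation f A a p.1) huv
      ((continuous_saddleDissipation hgrad A a).comp continuous_fst).continuousAt
      (h.tendsto_saddleDissipation hA hconv hf he)
  have hsecond : A (-∇ f u - A u - A v) = 0 :=
    eq_of_mapClusterPt_of_tendsto (p := (u, v)) (Φ := fun p => A (-∇ f p.1 - A p.1 - A p.2)) huv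
      (by fun_prop) (h.tendsto_apply_deriv_primal hA hconv hf he)
  have hstationary : ∇ f u = -A b := by
    rw [gradient_eq_of_saddleDissipation_eq_zero hA hconv hf hdiss,
      eq_neg_of_add_eq_zero_right he.stationary]
  rw [hstationary, hfeasible, neg_neg, sub_zero, ← map_sub] at hsecond
  -- A symmetric operator has the same kernel as its square.
  have hker : A (b - v) = 0 := by
    rw [← inner_self_eq_zero (𝕜 := ℝ), hA.inner_left_eq_inner_right, hsecond, inner_zero_right]
  rw [map_sub, sub_eq_zero] at hker
  exact ⟨hfeasible, by rw [hstationary, hker, add_neg_cancel]⟩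

theorem exists_tendsto [FiniteDimensional ℝ E] (h : IsSaddleFlow f A y l) (hA : A.IsPositive)
    (hconv : ConvexOn ℝ univ f) (hf : Differentiable ℝ f) (he : IsSaddleEquilibrium f A a b) :
    ∃ u v, IsSaddleEquilibrium f A u v ∧ Tendsto y atTop (𝓝 u) ∧ Tendsto l atTop (𝓝 v) := by
  obtain ⟨K, hK, hmaps⟩ := h.exists_isCompact_mapsTo hA hconv hf he
  obtain ⟨⟨u, v⟩, -, hcluster⟩ := hK.exists_mapClusterPt (f := atTop) (u := fun t => (y t, l t))
    (tendsto_principal.2 ((eventually_ge_atTop 0).mono hmaps))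
  have huv := h.isSaddleEquilibrium_of_mapClusterPt hA hconv hf he hcluster
  -- The cluster point is an equilibrium, so it can replace `(a, b)` as the center of the energy.
  obtain ⟨c, hc⟩ := h.exists_tendsto_saddleEnergy hA hconv hf huv
  have hzero : saddleEnergy u v u v = c :=
    eq_of_mapClusterPt_of_tendsto (p := (u, v)) hcluster
      (continuous_saddleEnergy u v).continuousAt hc
  rw [saddleEnergy_self] at hzero
  exact ⟨u, v, huv, tendsto_of_tendsto_saddleEnergy_zero (hzero ▸ hc)⟩

end IsSaddleFlow

/-- The Laplacian matrix of a finite weighted graph with weights `c`. It does not depend on the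
diagonal values `c i i`, which are therefore unconstrained. -/
def weightedLaplacian {ι R : Type*} [Fintype ι] [DecidableEq ι] [AddCommGroup R]
    (c : ι → ι → R) : Matrix ι ι R :=
  Matrix.diagonal (fun i => ∑ j, c i j) - Matrix.of c

section WeightedLaplacian

open scoped InnerProductSpace

variable {ι : Type*} [Fintype ι] [DecidableEq ι] {c : ι → ι → ℝ}

theorem toEuclideanLin_weightedLaplacian_apply (c : ι → ι → ℝ) (v : EuclideanSpace ℝ ι) (i : ι) :
    Matrix.toEuclideanLin (weightedLaplacian c) v i = ∑ j, c i j * (v i - v j) := by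
  simp only [weightedLaplacian, Matrix.toLpLin_apply, Matrix.sub_mulVec, Pi.sub_apply,
    Matrix.mulVec_diagonal, mul_sub, Finset.sum_sub_distrib, Finset.sum_mul]
  rfl

theorem inner_toEuclideanLin_weightedLaplacian (hc : ∀ i j, c i j = c j i)
    (u v : EuclideanSpace ℝ ι) :
    ⟪Matrix.toEuclideanLin (weightedLaplacian c) u, v⟫_ℝ =
      1 / 2 * ∑ i, ∑ j, c i j * ((u i - u j) * (v i - v j)) := by
  have hsum : ⟪Matrix.toEuclideanLin (weightedLaplacian c) u, v⟫_ℝ =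
      ∑ i, ∑ j, c i j * (u i - u j) * v i := by
    simp only [PiLp.inner_apply, toEuclideanLin_weightedLaplacian_apply, RCLike.inner_apply,
      conj_trivial, mul_comm (v _), Finset.sum_mul]
  have hswap : ∑ i, ∑ j, c i j * (u i - u j) * v i = -∑ i, ∑ j, c i j * (u i - u j) * v j := by
    rw [Finset.sum_comm, ← Finset.sum_neg_distrib]
    refine Finset.sum_congr rfl fun i _ => ?_
    rw [← Finset.sum_neg_distrib]
    refine Finset.sum_congr rfl fun j _ => ?_
    rw [hc j i]
    ring
  have hsplit : ∑ i, ∑ j, c i j * ((u i - u j) * (v i - v j)) =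
      ∑ i, ∑ j, c i j * (u i - u j) * v i - ∑ i, ∑ j, c i j * (u i - u j) * v j := by
    simp only [← mul_assoc, mul_sub (_ * _), Finset.sum_sub_distrib]
  rw [hsum, hsplit]
  linarith

theorem isPositive_toEuclideanLin_weightedLaplacian (hc : ∀ i j, c i j = c j i)
    (hc0 : ∀ i j, 0 ≤ c i j) : (Matrix.toEuclideanLin (weightedLaplacian c)).IsPositive := by
  refine (LinearMap.isPositive_iff _).2 ⟨fun u v => ?_, fun v => ?_⟩
  · rw [real_inner_comm _ u, inner_toEuclideanLin_weightedLaplacian hc,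
      inner_toEuclideanLin_weightedLaplacian hc]
    simp only [mul_comm (u _ - u _)]
  · rw [inner_toEuclideanLin_weightedLaplacian hc]
    exact mul_nonneg one_half_pos.le (Finset.sum_nonneg fun i _ => Finset.sum_nonneg fun j _ =>
      mul_nonneg (hc0 i j) (mul_self_nonneg _))

theorem eq_of_toEuclideanLin_weightedLaplacian_eq_zero (hc : ∀ i j, c i j = c j i)
    (hc0 : ∀ i j, 0 ≤ c i j) {v : EuclideanSpace ℝ ι}
    (hv : Matrix.toEuclideanLin (weightedLaplacian c) v = 0) {i j : ι} (hij : 0 < c i j) :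
    v i = v j := by
  have hterm : ∀ i j, 0 ≤ c i j * ((v i - v j) * (v i - v j)) := fun i j =>
    mul_nonneg (hc0 i j) (mul_self_nonneg _)
  have hform := inner_toEuclideanLin_weightedLaplacian hc v v
  rw [hv, inner_zero_left, zero_eq_mul, or_iff_right one_half_pos.ne',
    Finset.sum_eq_zero_iff_of_nonneg fun i _ => Finset.sum_nonneg fun j _ => hterm i j] at hform
  have hzero := (Finset.sum_eq_zero_iff_of_nonneg fun j _ => hterm i j).1
    (hform i (Finset.mem_univ i)) j (Finset.mem_univ j)
  exact sub_eq_zero.1 (mul_self_eq_zero.1 ((mul_eq_zero.1 hzero).resolve_left hij.ne'))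

theorem ker_toEuclideanLin_weightedLaplacian (hc : ∀ i j, c i j = c j i)
    (hc0 : ∀ i j, 0 ≤ c i j) {G : SimpleGraph ι} (hG : G.Connected)
    (hpos : ∀ i j, G.Adj i j → 0 < c i j) :
    LinearMap.ker (Matrix.toEuclideanLin (weightedLaplacian c)) =
      ℝ ∙ WithLp.toLp 2 (fun _ : ι => (1 : ℝ)) := by
  refine le_antisymm (fun v hv => ?_) ((Submodule.span_singleton_le_iff_mem _ _).2 ?_)
  · have hreach : ∀ i j, Relation.ReflTransGen G.Adj i j → v i = v j := fun i j h => by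
      induction h with
      | refl => rfl
      | tail _ hadj ih =>
        exact ih.trans (eq_of_toEuclideanLin_weightedLaplacian_eq_zero hc hc0 hv (hpos _ _ hadj))
    obtain ⟨i₀⟩ := hG.nonempty
    refine Submodule.mem_span_singleton.2 ⟨v i₀, PiLp.ext fun i => ?_⟩
    simpa using hreach i₀ i ((SimpleGraph.reachable_iff_reflTransGen i₀ i).1 (hG i₀ i))
  · refine LinearMap.mem_ker.2 (PiLp.ext fun i => ?_)
    rw [toEuclideanLin_weightedLaplacian_apply]
    simp

end WeightedLaplacian

namespace MultiplexNetwork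

variable {N M : ℕ} (G : MultiplexNetwork N M)

/-- The coefficient of diffusion between two replica nodes: the supra-Laplacian is the Laplacian of
the weighted graph with these weights. -/
def diffusionCoeff (p q : Fin N × Fin M) : ℝ :=
  (if p.2 = q.2 then G.D p.2 * G.w p.2 p.1 q.1 else 0) +
    if p.1 = q.1 ∧ p.2 ≠ q.2 then G.Dinter p.2 q.2 else 0

theorem diffusionCoeff_comm (p q : Fin N × Fin M) :
    G.diffusionCoeff p q = G.diffusionCoeff q p := by
  obtain ⟨i, α⟩ := p
  obtain ⟨j, β⟩ := q
  rcases eq_or_ne α β with rfl | hαβ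
  · simp [diffusionCoeff, G.w_symm α i j]
  · simp [diffusionCoeff, hαβ, hαβ.symm, G.Dinter_symm α β, eq_comm]

theorem diffusionCoeff_nonneg (p q : Fin N × Fin M) : 0 ≤ G.diffusionCoeff p q := by
  have hintra := mul_nonneg (G.D_nonneg p.2) (G.w_nonneg p.2 p.1 q.1)
  have hinter := G.Dinter_nonneg p.2 q.2
  unfold diffusionCoeff
  split_ifs <;> linarith

theorem diffusionCoeff_pos_of_adj {p q : Fin N × Fin M} (h : G.replicaGraph.Adj p q) :
    0 < G.diffusionCoeff p q := by
  obtain ⟨i, α⟩ := p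
  obtain ⟨j, β⟩ := q
  obtain ⟨hne, ⟨hlayer, hpos⟩ | ⟨hnode, hpos⟩⟩ := h
  · obtain rfl : α = β := hlayer
    simpa [diffusionCoeff] using hpos
  · obtain rfl : i = j := hnode
    have hαβ : α ≠ β := fun hαβ => hne (by rw [hαβ])
    simpa [diffusionCoeff, hαβ] using hpos

theorem sum_diffusionCoeff (i : Fin N) (α : Fin M) :
    ∑ q, G.diffusionCoeff (i, α) q =
      G.D α * ∑ j, G.w α i j + ∑ β ∈ Finset.univ.erase α, G.Dinter α β := by
  have hinter : ∀ j, ∑ β, (if i = j ∧ α ≠ β then G.Dinter α β else 0) =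
      if i = j then ∑ β ∈ Finset.univ.erase α, G.Dinter α β else 0 := fun j => by
    split_ifs with hij <;> simp [hij, Finset.sum_ite, Finset.filter_ne]
  simp [diffusionCoeff, Finset.sum_add_distrib, Fintype.sum_prod_type, hinter, Finset.mul_sum]

theorem supraLaplacian_eq_weightedLaplacian :
    G.supraLaplacian = weightedLaplacian G.diffusionCoeff := by
  ext ⟨i, α⟩ ⟨j, β⟩
  rcases eq_or_ne α β with rfl | hαβ <;> rcases eq_or_ne i j with rfl | hij
  · have hself : G.diffusionCoeff (i, α) (i, α) = G.D α * G.w α i i := by simp [diffusionCoeff]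
    simp [supraLaplacian, intraPart, interPart, layerLaplacian, weightedLaplacian,
      sum_diffusionCoeff, hself, mul_sub, sub_add_eq_add_sub]
  all_goals simp [supraLaplacian, intraPart, interPart, layerLaplacian, weightedLaplacian,
      Matrix.blockDiagonal_apply, diffusionCoeff, *]

theorem isPositive_supraLap : G.supraLap.IsPositive := by
  rw [supraLap, supraLaplacian_eq_weightedLaplacian]
  exact isPositive_toEuclideanLin_weightedLaplacian G.diffusionCoeff_comm G.diffusionCoeff_nonneg

theorem ker_supraLap (hG : G.Connected) : LinearMap.ker G.supraLap = ℝ ∙ onesVec N M := by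
  rw [supraLap, supraLaplacian_eq_weightedLaplacian]
  exact ker_toEuclideanLin_weightedLaplacian G.diffusionCoeff_comm G.diffusionCoeff_nonneg hG
    fun _ _ => G.diffusionCoeff_pos_of_adj

variable {G}

theorem IsTrajectory.isSaddleFlow {f : ReplicaSpace N M → ℝ} {y l : ℝ → ReplicaSpace N M}
    (h : G.IsTrajectory f y l) :
    IsSaddleFlow f (LinearMap.toContinuousLinearMap G.supraLap) y l :=
  ⟨h.primal, h.dual⟩

end MultiplexNetwork

section Replica

open scoped InnerProductSpace

variable {N M : ℕ}

theorem isMinOn_primalObjective_iff {f : ReplicaSpace N M → ℝ} {x : ℝ} :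
    IsMinOn (primalObjective f) univ x ↔ IsMinOn f (ℝ ∙ onesVec N M) (x • onesVec N M) := by
  simp [isMinOn_iff, primalObjective, Submodule.mem_span_singleton]

theorem inner_onesVec (v : ReplicaSpace N M) : ⟪v, onesVec N M⟫_ℝ = ∑ p, v p := by
  simp [PiLp.inner_apply, onesVec]

theorem inner_replicaAverage_smul_onesVec (v : ReplicaSpace N M) :
    ⟪replicaAverage v • onesVec N M, onesVec N M⟫_ℝ = ⟪v, onesVec N M⟫_ℝ := by
  rcases isEmpty_or_nonempty (Fin N × Fin M) with hempty | ⟨⟨p⟩⟩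
  · simp [inner_onesVec]
  · have hN : (N : ℝ) ≠ 0 := Nat.cast_ne_zero.2 p.1.pos.ne'
    have hM : (M : ℝ) ≠ 0 := Nat.cast_ne_zero.2 p.2.pos.ne'
    have hcard : ∑ p, onesVec N M p = N * M := by simp [onesVec]
    rw [real_inner_smul_left, inner_onesVec, inner_onesVec, hcard, replicaAverage,
      div_mul_cancel₀ _ (mul_ne_zero hN hM)]

end Replica

theorem mainTheorem1_general {N M : ℕ} (G : MultiplexNetwork N M) (hG : G.Connected)
    (f : ReplicaSpace N M → ℝ) (hf : Differentiable ℝ f) (hconv : ConvexOn ℝ univ f)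
    (hmin : ∃ x : ℝ, IsMinOn (primalObjective f) univ x)
    (y l : ℝ → ReplicaSpace N M) (htraj : G.IsTrajectory f y l) :
    ∃ ystar lstar : ReplicaSpace N M,
      Tendsto y atTop (𝓝 ystar) ∧ Tendsto l atTop (𝓝 lstar) ∧
      IsSaddlePointOn univ univ (G.augLagrangian f) ystar lstar ∧
      (∃ xstar : ℝ, ystar = xstar • onesVec N M ∧ IsMinOn (primalObjective f) univ xstar) ∧
      (∃ lbar : ReplicaSpace N M,
        lstar = lbar + replicaAverage (l 0) • onesVec N M ∧
        inner ℝ lbar (onesVec N M) = 0 ∧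
        G.supraLap lbar + gradient f ystar = 0) := by
  set A := LinearMap.toContinuousLinearMap G.supraLap
  have hA : A.IsPositive := G.isPositive_supraLap
  have hker : A.ker = ℝ ∙ onesVec N M := G.ker_supraLap hG
  have hones : ∀ x : ℝ, A (x • onesVec N M) = 0 := fun x =>
    hker.ge (Submodule.smul_mem _ x (Submodule.mem_span_singleton_self _))
  have hflow : IsSaddleFlow f A y l := htraj.isSaddleFlow
  obtain ⟨x, hx⟩ := hmin
  obtain ⟨b, hb⟩ := exists_isSaddleEquilibrium_of_isMinOn_ker hA.isSymmetric (hf _) (hones x)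
    (hker ▸ isMinOn_primalObjective_iff.1 hx)
  obtain ⟨ystar, lstar, heq, hy, hl⟩ := hflow.exists_tendsto hA hconv hf hb
  obtain ⟨xstar, rfl⟩ := Submodule.mem_span_singleton.1 (hker.le heq.feasible)
  have hmean := hflow.inner_eq_of_tendsto_dual hA.isSymmetric hl (by simpa using hones 1)
  refine ⟨_, lstar, hy, hl, heq.isSaddlePointOn hA hconv (hf _), ⟨xstar, rfl, ?_⟩,
    lstar - replicaAverage (l 0) • onesVec N M, (sub_add_cancel _ _).symm, ?_,
    (heq.sub_right (hones _)).stationary⟩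
  · exact isMinOn_primalObjective_iff.2 (hker ▸ heq.isMinOn_ker hA hconv (hf _))
  · rw [inner_sub_left, inner_replicaAverage_smul_onesVec, hmean, sub_self]

theorem mainTheorem1 {N M : ℕ} (G : MultiplexNetwork N M) (hG : G.Connected)
    (f : ReplicaSpace N M → ℝ) (hf : ContDiff ℝ 2 f) (hconv : ConvexOn ℝ univ f)
    (hmin : ∃ x : ℝ, IsMinOn (primalObjective f) univ x)
    (y l : ℝ → ReplicaSpace N M) (htraj : G.IsTrajectory f y l) :
    ∃ ystar lstar : ReplicaSpace N M,
      Tendsto y atTop (𝓝 ystar) ∧ Tendsto l atTop (𝓝 lstar) ∧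
      IsSaddlePointOn univ univ (G.augLagrangian f) ystar lstar ∧
      (∃ xstar : ℝ, ystar = xstar • onesVec N M ∧ IsMinOn (primalObjective f) univ xstar) ∧
      (∃ lbar : ReplicaSpace N M,
        lstar = lbar + replicaAverage (l 0) • onesVec N M ∧
        inner ℝ lbar (onesVec N M) = 0 ∧
        G.supraLap lbar + gradient f ystar = 0) := by
  exact mainTheorem1_general G hG f (hf.differentiable two_ne_zero) hconv hmin y l htraj
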